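/- **Conventions.** A *generalised hexagon* is a nonempty point-line geometry $\Gamma$ containing no ordinary $2$-, $3$-, $4$- or $5$-gon and in which any two elements (points or lines) lie in an ordinary hexagon (an *apartment*). It is *thick* if every element is incident with at least three elements. A *root* is a path $\alpha=(x_0,\dots,x_6)$ of seven consecutive elements of an apartment; its *root group* $U_\alpha$ consists of the collineations (type-preserving automorphisms) of $\Gamma$ fixing every element incident with one of $x_1,\dots,x_5$. A *Moufang hexagon* is a thick generalised hexagon in which, for every root $\alpha$, the group $U_\alpha$ is transitive on the elements incident with $x_0$ and different from $x_1$. A *hexagonal system* $(\mathbb J,\mathbb F,\#)$ consists of a commutative field $\mathbb F$, an $\mathbb F$-vector space $\mathbb J$, a map $\#:\mathbb J\to\mathbb J$, a map $\mathsf N:\mathbb J\to\mathbb F$, a symmetric bilinear form $\mathsf T:\mathbb J\times\mathbb J\to\mathbb F$, a symmetric bilinear map $\times:\mathbb J\times\mathbb J\to\mathbb J$ and an element $1\in\mathbb J\setminus\{0\}$ such that for all $t\in\mathbb F$ and $a,b,c\in\mathbb J$: $(ta)^\#=t^2a^\#$; $\mathsf N(ta)=t^3\mathsf N(a)$; $\mathsf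 T(a\times b,c)=\mathsf T(a,b\times c)$; $(a+b)^\#=a^\#+a\times b+b^\#$; $\mathsf N(a+b)=\mathsf N(a)+\mathsf T(a^\#,b)+\mathsf T(a,b^\#)+\mathsf N(b)$; $\mathsf T(a,a^\#)=3\mathsf N(a)$; $a^{\#\#}=\mathsf N(a)a$; $a^\#\times(a\times b)=\mathsf N(a)b+\mathsf T(a^\#,b)a$; $a^\#\times b^\#+(a\times b)^\#=\mathsf T(a^\#,b)b+\mathsf T(a,b^\#)a$; $1^\#=1$; $a=\mathsf T(a,1)1-1\times a$; and $\mathsf N(a)=0$ if and only if $a=0$. A Moufang hexagon $\Gamma$ is *associated* to $(\mathbb J,\mathbb F,\#)$ if it has an apartment, with elements labelled cyclically by the integers modulo $12$, the element $7$ being a point and $6$ a line, and isomorphisms $x_i$ from the additive group of $\mathbb J$ ($i$ odd) or of $\mathbb F$ ($i$ even) onto the root group $U_i$ of the root $(i,i+1,\dots,i+6)$, $1\le i\le 6$, such that, with $[g,h]=g^{-1}h^{-1}gh$, $$[x_1(a),x_3(b)]=x_2(\mathsf T(a,b)),\qquad [x_3(a),x_5(b)]=x_4(\mathsf T(a,b)),\qquad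 [x_2(t),x_6(u)]=x_4(tu),$$ $$[x_1(a),x_5(b)]=x_2(-\mathsf T(a^\#,b))\,x_3(a\times b)\,x_4(\mathsf T(a,b^\#)),$$ $$[x_1(a),x_6(t)]=x_2(-t\mathsf N(a))\,x_3(ta^\#)\,x_4(t^2\mathsf N(a))\,x_5(-ta)$$ for all $a,b\in\mathbb J$ and $t,u\in\mathbb F$, and all other commutators of elements of $U_i$ and $U_j$ ($1\le i<j\le 6$) are trivial. (Thus the points on a line are indexed by $\{\infty\}\cup\mathbb F$ and the lines through a point by $\{\infty\}\cup\mathbb J$.) The hexagon $\Gamma$ is in *class* $(\mathrm{H4})$, or *mixed*, if it is associated to a hexagonal system $(\mathbb E,\mathbb F,\#)$ where $\operatorname{char}\mathbb F=3$, $\mathbb E$ is a field with $\mathbb E^3\subseteq\mathbb F\subseteq\mathbb E$ (possibly $\mathbb E=\mathbb F$), and $a^\#=a^2$, $\mathsf N(a)=a^3$, $\mathsf T(a,b)=3ab=0$, $a\times b=2ab$. **Lemma.** Let $\Gamma$ be a Moufang hexagon associated to a hexagonal system $(\mathbb J,\mathbb F,\#)$. There exists a collineation of $\Gamma$ whose set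 of fixed elements is precisely a ball of radius $3$ in the incidence graph centred at a line if and only if $\Gamma$ is in class $(\mathrm{H4})$. In this case all such collineations are conjugate, in the full collineation group of $\Gamma$, to the short root elation $x_3(1)$. -/

import Mathlib

universe u v w z

/-! ### Hexagonal systems -/

/-- A hexagonal system `(J, F, #)` (an anisotropic cubic norm structure) in the sense of
Tits and Weiss, together with its norm `N`, trace form `T`, product `×` and unit `1`
(all of which are determined by `#`). -/
structure HexagonalSystem (F : Type u) (J : Type v) [Field F] [AddCommGroup J] [Module F J] where
  /-- the adjoint `#` -/
  sharp : J → J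
  /-- the norm `N` -/
  N : J → F
  /-- the trace form `T(·,·)` -/
  T : J →ₗ[F] J →ₗ[F] F
  /-- the bilinear product `×` -/
  cross : J →ₗ[F] J →ₗ[F] J
  /-- the unit `1` -/
  one : J
  one_ne_zero : one ≠ 0
  T_symm : ∀ a b, T a b = T b a
  cross_symm : ∀ a b, cross a b = cross b a
  sharp_smul : ∀ (t : F) (a : J), sharp (t • a) = t ^ 2 • sharp a
  N_smul : ∀ (t : F) (a : J), N (t • a) = t ^ 3 * N a
  T_cross : ∀ a b c, T (cross a b) c = T a (cross b c)
  sharp_add : ∀ a b, sharp (a + b) = sharp a + cross a b + sharp b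
  N_add : ∀ a b, N (a + b) = N a + T (sharp a) b + T a (sharp b) + N b
  T_sharp : ∀ a, T a (sharp a) = 3 * N a
  sharp_sharp : ∀ a, sharp (sharp a) = N a • a
  sharp_cross_cross : ∀ a b, cross (sharp a) (cross a b) = N a • b + T (sharp a) b • a
  sharp_cross_sharp : ∀ a b,
    cross (sharp a) (sharp b) + sharp (cross a b) = T (sharp a) b • b + T a (sharp b) • a
  sharp_one : sharp one = one
  eq_T_sub_cross : ∀ a, a = T a one • one - cross one a
  N_eq_zero_iff : ∀ a, N a = 0 ↔ a = 0

/-- The hexagonal system `(E, F, #)` of a field extension `E / F` with `char F = 3` and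
`E³ ⊆ F ⊆ E`: here `a^# = a²`, `N(a) = a³`, `T(a, b) = 3ab = 0`, `a × b = 2ab`. The case
`E = F` is allowed. -/
noncomputable def mixedSystem (F : Type u) (E : Type v) [Field F] [Field E] [Algebra F E]
    [CharP F 3] (h : ∀ a : E, ∃ t : F, algebraMap F E t = a ^ 3) : HexagonalSystem F E :=
  have h3 : (3 : F) = 0 := CharP.cast_eq_zero F 3
  have h3' : (3 : E) = 0 := by
    rw [← map_ofNat (algebraMap F E) 3, h3, map_zero]
  have inj : Function.Injective (algebraMap F E) := (algebraMap F E).injective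
  have hc : ∀ a b : E, ((2 : F) • LinearMap.mul F E) a b = 2 * (a * b) := fun a b => by
    rw [LinearMap.smul_apply, LinearMap.smul_apply, LinearMap.mul_apply', Algebra.smul_def,
      map_ofNat]
  { sharp := fun a => a ^ 2
    N := fun a => (h a).choose
    T := 0
    cross := (2 : F) • LinearMap.mul F E
    one := 1
    one_ne_zero := one_ne_zero
    T_symm := fun a b => by simp
    cross_symm := fun a b => by simp [mul_comm]
    sharp_smul := fun t a => by simp only [Algebra.smul_def, map_pow]; ring
    N_smul := fun t a => by
      apply inj
      rw [(h (t • a)).choose_spec, map_mul, (h a).choose_spec, Algebra.smul_def, map_pow]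
      ring
    T_cross := fun a b c => by simp
    sharp_add := fun a b => by
      rw [hc]; ring
    N_add := fun a b => by
      apply inj
      simp only [LinearMap.zero_apply, add_zero]
      rw [(h (a + b)).choose_spec, map_add, (h a).choose_spec, (h b).choose_spec]
      linear_combination (a ^ 2 * b + a * b ^ 2) * h3'
    T_sharp := fun a => by simp [h3]
    sharp_sharp := fun a => by
      rw [Algebra.smul_def, (h a).choose_spec]; ring
    sharp_cross_cross := fun a b => by
      rw [hc, hc, LinearMap.zero_apply, LinearMap.zero_apply, zero_smul, Algebra.smul_def,
        (h a).choose_spec]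
      linear_combination (a ^ 3 * b) * h3'
    sharp_cross_sharp := fun a b => by
      rw [hc, hc]
      simp only [LinearMap.zero_apply, zero_smul]
      linear_combination (2 * a ^ 2 * b ^ 2) * h3'
    sharp_one := one_pow 2
    eq_T_sub_cross := fun a => by
      rw [hc]
      simp only [LinearMap.zero_apply, zero_smul]
      linear_combination a * h3'
    N_eq_zero_iff := fun a => by
      rw [← inj.eq_iff, (h a).choose_spec, map_zero]
      exact pow_eq_zero_iff (by norm_num) }

/-! ### Point-line geometries and generalised hexagons -/

/-- A point-line geometry with point set `P` and line set `L`. -/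
structure PointLineGeometry (P : Type w) (L : Type z) where
  /-- incidence -/
  Inc : P → L → Prop

namespace PointLineGeometry

variable {P : Type w} {L : Type z}

/-- The incidence graph, with vertex set the disjoint union of points and lines. -/
def incGraph (Γ : PointLineGeometry P L) : SimpleGraph (P ⊕ L) where
  Adj x y := (∃ p l, x = Sum.inl p ∧ y = Sum.inr l ∧ Γ.Inc p l) ∨
    (∃ p l, x = Sum.inr l ∧ y = Sum.inl p ∧ Γ.Inc p l)
  symm := ⟨by
    rintro x y (⟨p, l, hx, hy, h⟩ | ⟨p, l, hx, hy, h⟩)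
    · exact Or.inr ⟨p, l, hy, hx, h⟩
    · exact Or.inl ⟨p, l, hy, hx, h⟩⟩
  loopless := ⟨by
    rintro x (⟨p, l, hx, hy, -⟩ | ⟨p, l, hx, hy, -⟩) <;> simp [hx] at hy⟩

/-- A circuit of length `n` in the incidence graph. For `n = 2k` with `k ≥ 2`, this is an ordinary
`k`-gon (with a starting element and a direction). -/
def IsCircuit (Γ : PointLineGeometry P L) (n : ℕ) (c : ZMod n → P ⊕ L) : Prop :=
  Function.Injective c ∧ ∀ i, Γ.incGraph.Adj (c i) (c (i + 1))

/-- An apartment: an ordinary hexagon, its 12 elements labelled cyclically. -/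
def IsApartment (Γ : PointLineGeometry P L) (c : ZMod 12 → P ⊕ L) : Prop :=
  Γ.IsCircuit 12 c

/-- Generalised hexagons: nonempty, without ordinary `2`-, `3`-, `4`-, `5`-gons, and such that any
two elements are contained in an ordinary hexagon. -/
structure IsGeneralizedHexagon (Γ : PointLineGeometry P L) : Prop where
  nonempty : Nonempty (P ⊕ L)
  no_small_polygon : ∀ k : ℕ, 2 ≤ k → k ≤ 5 → ∀ c : ZMod (2 * k) → P ⊕ L, ¬ Γ.IsCircuit (2 * k) c
  exists_apartment : ∀ x y : P ⊕ L,
    ∃ c : ZMod 12 → P ⊕ L, Γ.IsApartment c ∧ x ∈ Set.range c ∧ y ∈ Set.range c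

/-- Thickness: every element is incident with at least three elements. -/
def IsThick (Γ : PointLineGeometry P L) : Prop :=
  ∀ x : P ⊕ L, 3 ≤ (Γ.incGraph.neighborSet x).encard

/-- The full collineation group: pairs of a permutation of the points and a permutation of the
lines that preserve incidence in both directions; multiplication is composition. -/
def collineationGroup (Γ : PointLineGeometry P L) :
    Subgroup (Equiv.Perm P × Equiv.Perm L) where
  carrier := {g | ∀ p l, Γ.Inc (g.1 p) (g.2 l) ↔ Γ.Inc p l}
  one_mem' := fun _ _ => Iff.rfl
  mul_mem' := fun {g h} hg hh p l => (hg (h.1 p) (h.2 l)).trans (hh p l)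
  inv_mem' := fun {g} hg p l => by
    have := hg (g.1⁻¹ p) (g.2⁻¹ l)
    simpa using this.symm

/-- Collineations of `Γ`. -/
abbrev Collineation (Γ : PointLineGeometry P L) : Type (max w z) := Γ.collineationGroup

/-- The image of an element (point or line) under a collineation. -/
def Collineation.act {Γ : PointLineGeometry P L} (θ : Γ.Collineation) : P ⊕ L → P ⊕ L :=
  Sum.map θ.1.1 θ.1.2

/-- The root group `U_α` of the root `α = (c i, c (i+1), …, c (i+6))`: the collineations fixing all
elements incident with one of the interior elements `c (i+1), …, c (i+5)`. -/
def rootGroup (Γ : PointLineGeometry P L) (c : ZMod 12 → P ⊕ L) (i : ZMod 12) :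
    Subgroup Γ.Collineation where
  carrier := {θ | ∀ k : ℕ, 1 ≤ k → k ≤ 5 → ∀ y, Γ.incGraph.Adj (c (i + k)) y → θ.act y = y}
  one_mem' := fun _ _ _ y _ => by cases y <;> rfl
  mul_mem' := fun {g h} hg hh k h1 h5 y hy => by
    have e : (g * h).act y = g.act (h.act y) := by cases y <;> rfl
    rw [e, hh k h1 h5 y hy, hg k h1 h5 y hy]
  inv_mem' := fun {g} hg k h1 h5 y hy => by
    have e : g⁻¹.act (g.act y) = y := by
      cases y <;> simp [Collineation.act]
    have := hg k h1 h5 y hy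
    rwa [this] at e

/-- Moufang hexagons: thick generalised hexagons such that for every root
`α = (x₀, …, x₆)` the root group `U_α` is transitive on the elements incident with `x₀` other
than `x₁` (equivalently, on the apartments containing `α`). -/
structure IsMoufangHexagon (Γ : PointLineGeometry P L) : Prop where
  hexagon : Γ.IsGeneralizedHexagon
  thick : Γ.IsThick
  moufang : ∀ c : ZMod 12 → P ⊕ L, Γ.IsApartment c → ∀ (i : ZMod 12) (y y' : P ⊕ L),
    Γ.incGraph.Adj (c i) y → y ≠ c (i + 1) → Γ.incGraph.Adj (c i) y' → y' ≠ c (i + 1) →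
    ∃ θ ∈ Γ.rootGroup c i, θ.act y = y'

/-- `θ` fixes precisely the elements of a ball of radius 3 in the incidence graph centred at a
line. -/
def FixesExactlyLineBall (Γ : PointLineGeometry P L) (θ : Γ.Collineation) : Prop :=
  ∃ l : L, ∀ x : P ⊕ L, θ.act x = x ↔ Γ.incGraph.edist (Sum.inr l) x ≤ 3

/-- `x` is an isomorphism from the additive group `A` onto the subgroup `U`. -/
def IsLabelling {G : Type*} [Group G] {A : Type*} [AddCommGroup A] (U : Subgroup G)
    (x : A → G) : Prop :=
  Function.Injective x ∧ Set.range x = U ∧ ∀ a b, x (a + b) = x a * x b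

/-- The commutator `[g, h] = g⁻¹h⁻¹gh`. -/
def comm {G : Type*} [Group G] (g h : G) : G := g⁻¹ * h⁻¹ * g * h

/-- `Γ` is associated to the hexagonal system `(J, F, #)`: an apartment with elements labelled by
the integers modulo `12`, and labellings `x₁, …, x₆` by `J` (odd index) and `F` (even index) of the
root groups `U₁, …, U₆`, where `Uᵢ` belongs to the root `(i, i+1, …, i+6)`, such that the
commutator relations of `(J, F, #)` hold. The chamber fixed by `U₁, …, U₆` is `{6, 7}`; the
element `7` is a point and `6` is a line, so `U₁` permutes regularly the lines other
than `6` through the point `7`, and `U₆` the points other than `7` on the line `6`: the points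
on a line are indexed by `{∞} ∪ F`, and the lines through a point by `{∞} ∪ J`. -/
structure AssociatedTo {F : Type u} {J : Type v} [Field F] [AddCommGroup J] [Module F J]
    (Γ : PointLineGeometry P L) (S : HexagonalSystem F J) where
  /-- the apartment `A₀` -/
  apt : ZMod 12 → P ⊕ L
  isApartment : Γ.IsApartment apt
  apt_point : ∃ p, apt 7 = Sum.inl p
  x₁ : J → Γ.Collineation
  x₂ : F → Γ.Collineation
  x₃ : J → Γ.Collineation
  x₄ : F → Γ.Collineation
  x₅ : J → Γ.Collineation
  x₆ : F → Γ.Collineation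
  label₁ : IsLabelling (Γ.rootGroup apt 1) x₁
  label₂ : IsLabelling (Γ.rootGroup apt 2) x₂
  label₃ : IsLabelling (Γ.rootGroup apt 3) x₃
  label₄ : IsLabelling (Γ.rootGroup apt 4) x₄
  label₅ : IsLabelling (Γ.rootGroup apt 5) x₅
  label₆ : IsLabelling (Γ.rootGroup apt 6) x₆
  comm₁₂ : ∀ a t, comm (x₁ a) (x₂ t) = 1
  comm₁₃ : ∀ a b, comm (x₁ a) (x₃ b) = x₂ (S.T a b)
  comm₁₄ : ∀ a t, comm (x₁ a) (x₄ t) = 1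
  comm₁₅ : ∀ a b, comm (x₁ a) (x₅ b) =
    x₂ (-S.T (S.sharp a) b) * x₃ (S.cross a b) * x₄ (S.T a (S.sharp b))
  comm₁₆ : ∀ a t, comm (x₁ a) (x₆ t) =
    x₂ (-(t * S.N a)) * x₃ (t • S.sharp a) * x₄ (t ^ 2 * S.N a) * x₅ (-(t • a))
  comm₂₃ : ∀ t a, comm (x₂ t) (x₃ a) = 1
  comm₂₄ : ∀ t u, comm (x₂ t) (x₄ u) = 1
  comm₂₅ : ∀ t a, comm (x₂ t) (x₅ a) = 1
  comm₂₆ : ∀ t u, comm (x₂ t) (x₆ u) = x₄ (t * u)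
  comm₃₄ : ∀ a t, comm (x₃ a) (x₄ t) = 1
  comm₃₅ : ∀ a b, comm (x₃ a) (x₅ b) = x₄ (S.T a b)
  comm₃₆ : ∀ a t, comm (x₃ a) (x₆ t) = 1
  comm₄₅ : ∀ t a, comm (x₄ t) (x₅ a) = 1
  comm₄₆ : ∀ t u, comm (x₄ t) (x₆ u) = 1
  comm₅₆ : ∀ a t, comm (x₅ a) (x₆ t) = 1

/-- Class (H4), the mixed hexagons: those associated to a hexagonal system `(E, F, #)` with
`char F = 3`, `E³ ⊆ F ⊆ E` and `a^# = a²`. -/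
def InClassH4 (Γ : PointLineGeometry P L) : Prop :=
  ∃ (F : Type u) (E : Type v) (_ : Field F) (_ : Field E) (_ : Algebra F E) (_ : CharP F 3)
    (h : ∀ a : E, ∃ t : F, algebraMap F E t = a ^ 3), Nonempty (Γ.AssociatedTo (mixedSystem F E h))

end PointLineGeometry

/-!
A collineation fixing precisely a ball of radius `3` around a line is conjugate to some `x₃(a)` with
`a ≠ 0` that fixes the ball around the line `6`. As `x₁(b)` fixes `6`, the commutator
`[x₁(b), x₃(a)] = x₂(T(b, a))` also fixes this ball; it lies in `U₂`, so it is trivial, and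
`T(a, ·) = 0`. The identity `a^# × (a × b) = N(a)b + T(a^#, b)a` then forces `T = 0`, whence
`3 = T(1, 1) = 0`, the norm is additive, and `ab = -(a × b)` makes `J` a field with `a^# = a²` and
`N(a)1 = a³`.

If `T = 0`, then `U₃` commutes with `U₁`, `U₅` and `U₆`; since these move the relevant neighbours
in the ball around `6`, each `x₃(a)` fixes this ball. For `a ≠ 0` there are `y, y' ∈ U₇` such that
`y x₁(a) y'` reflects the apartment, and its inverse conjugates `x₅(b)` to `x₃(ab)`. Hence `x₃(a)`
and `x₃(1)` are both conjugate to `x₅(1)`.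
-/

/-! ### Hexagonal systems with vanishing trace form -/

namespace HexagonalSystem

variable {F : Type u} {J : Type v} [Field F] [AddCommGroup J] [Module F J]
  (S : HexagonalSystem F J)

theorem T_eq_zero_of_radical {a : J} (ha : a ≠ 0) (h : ∀ b, S.T a b = 0) : S.T = 0 := by
  ext b c
  have hzero : S.T (S.cross (S.sharp a) (S.cross a b)) c = 0 := by
    rw [S.cross_symm, S.T_cross, S.T_cross, h]
  have heval : S.T (S.cross (S.sharp a) (S.cross a b)) c = S.N a * S.T b c := by
    simp only [S.sharp_cross_cross, map_add, map_smul, LinearMap.add_apply, LinearMap.smul_apply,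
      smul_eq_mul, h, mul_zero, add_zero]
  exact (mul_eq_zero.1 (heval ▸ hzero)).resolve_left (mt (S.N_eq_zero_iff a).1 ha)

theorem N_zero : S.N 0 = 0 := (S.N_eq_zero_iff 0).2 rfl

theorem N_one : S.N S.one = 1 := by
  apply smul_left_injective F S.one_ne_zero
  simp only [← S.sharp_sharp, S.sharp_one, one_smul]

theorem sharp_neg (a : J) : S.sharp (-a) = S.sharp a := by
  simpa using S.sharp_smul (-1) a

/-- The product `ab = -(a × b)`. If the trace form vanishes, it makes `J` a field with unit `1`,
in which `a^# = a²` and `N(a)1 = a³`. -/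
def mul : J →ₗ[F] J →ₗ[F] J := -S.cross

theorem mul_apply (a b : J) : S.mul a b = -S.cross a b := rfl

protected theorem mul_comm (a b : J) : S.mul a b = S.mul b a :=
  congrArg Neg.neg (S.cross_symm a b)

section TraceZero

variable (hT : S.T = 0)
include hT

protected theorem one_mul (a : J) : S.mul S.one a = a := by
  have h := S.eq_T_sub_cross a
  simpa only [mul_apply, hT, LinearMap.zero_apply, zero_smul, zero_sub] using h.symm

protected theorem mul_one (a : J) : S.mul a S.one = a := by
  rw [S.mul_comm, S.one_mul hT]

theorem charP_three : CharP F 3 := by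
  refine (CharP.charP_iff_prime_eq_zero Nat.prime_three).2 ?_
  simpa [hT, S.N_one] using (S.T_sharp S.one).symm

theorem mul_self (a : J) : S.mul a a = S.sharp a := by
  have := S.charP_three hT
  have h4 : (2 : F) ^ 2 = 1 := by linear_combination CharP.cast_eq_zero F 3
  have h := S.sharp_smul (2 : F) a
  rw [two_smul, h4, one_smul, S.sharp_add, add_eq_right] at h
  exact (eq_neg_of_add_eq_zero_left h).symm

theorem cross_eq_two_smul_mul (a b : J) : S.cross a b = (2 : F) • S.mul a b := by
  have := S.charP_three hT
  have h2 : (2 : F) = -1 := by linear_combination CharP.cast_eq_zero F 3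
  rw [h2, neg_one_smul, mul_apply, neg_neg]

theorem mul_sharp_mul (a b : J) : S.mul (S.sharp a) (S.mul a b) = S.N a • b := by
  simp only [mul_apply, map_neg, neg_neg, S.sharp_cross_cross, hT, LinearMap.zero_apply, zero_smul,
    add_zero]

theorem mul_sharp (a : J) : S.mul a (S.sharp a) = S.N a • S.one := by
  rw [S.mul_comm, ← S.mul_sharp_mul hT, S.mul_one hT]

theorem sharp_mul (a b : J) : S.sharp (S.mul a b) = S.mul (S.sharp a) (S.sharp b) := by
  have h := S.sharp_cross_sharp a b
  simp only [hT, LinearMap.zero_apply, zero_smul, add_zero] at h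
  rw [mul_apply, mul_apply, S.sharp_neg]
  exact (neg_eq_of_add_eq_zero_right h).symm

protected theorem mul_ne_zero {a b : J} (ha : a ≠ 0) (hb : b ≠ 0) : S.mul a b ≠ 0 := by
  intro h
  have hzero := S.mul_sharp_mul hT a b
  rw [h, map_zero, eq_comm, smul_eq_zero, S.N_eq_zero_iff] at hzero
  exact hzero.elim ha hb

theorem N_mul (a b : J) : S.N (S.mul a b) = S.N a * S.N b := by
  by_cases ha : a = 0
  · rw [ha, map_zero, LinearMap.zero_apply, S.N_zero, zero_mul]
  by_cases hb : b = 0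
  · rw [hb, map_zero, S.N_zero, mul_zero]
  apply smul_left_injective F (S.mul_ne_zero hT ha hb)
  simp only [← S.sharp_sharp (S.mul a b), S.sharp_mul hT, S.sharp_sharp, map_smul,
    LinearMap.smul_apply, smul_smul]
  rw [mul_comm]

theorem N_sub (a b : J) : S.N (a - b) = S.N a - S.N b := by
  have h := S.N_add (a - b) b
  simp only [sub_add_cancel, hT, LinearMap.zero_apply, add_zero] at h
  exact eq_sub_of_add_eq h.symm

/-- The norm is additive, multiplicative and injective, so associativity descends from `F`. -/
protected theorem mul_assoc (a b c : J) : S.mul (S.mul a b) c = S.mul a (S.mul b c) := by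
  rw [← sub_eq_zero, ← S.N_eq_zero_iff, S.N_sub hT]
  simp only [S.N_mul hT]
  ring

/-- `J` as a commutative ring under the product `HexagonalSystem.mul`. -/
abbrev commRing : CommRing J where
  __ := (inferInstance : AddCommGroup J)
  mul a b := S.mul a b
  one := S.one
  left_distrib a b c := map_add (S.mul a) b c
  right_distrib a b c := LinearMap.map_add₂ S.mul a b c
  zero_mul a := LinearMap.map_zero₂ S.mul a
  mul_zero a := map_zero (S.mul a)
  mul_assoc := S.mul_assoc hT
  one_mul := S.one_mul hT
  mul_one := S.mul_one hT
  mul_comm := S.mul_comm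

/-- `J` as a field, with inverse `N(a)⁻¹a^#`. -/
abbrev field : Field J where
  __ := S.commRing hT
  inv a := (S.N a)⁻¹ • S.sharp a
  exists_pair_ne := ⟨S.one, 0, S.one_ne_zero⟩
  mul_inv_cancel a ha := by
    change S.mul a ((S.N a)⁻¹ • S.sharp a) = S.one
    rw [map_smul, S.mul_sharp hT, smul_smul, inv_mul_cancel₀ (mt (S.N_eq_zero_iff a).1 ha),
      one_smul]
  inv_zero := by
    change (S.N 0)⁻¹ • S.sharp 0 = 0
    rw [S.N_zero, inv_zero, zero_smul]
  nnqsmul := _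
  nnqsmul_def _ _ := rfl
  qsmul := _
  qsmul_def _ _ := rfl

/-- `J` as a field extension of `F`, with the given scalar multiplication. -/
abbrev algebra : @Algebra F J _ (S.field hT).toSemiring :=
  letI := S.field hT
  Algebra.ofModule (LinearMap.map_smul₂ S.mul) fun r a b => map_smul (S.mul a) r b

theorem algebraMap_N (a : J) :
    letI := S.field hT
    letI := S.algebra hT
    algebraMap F J (S.N a) = a ^ 3 := by
  let _ := S.field hT
  let _ := S.algebra hT
  rw [Algebra.algebraMap_eq_smul_one, pow_three]
  change S.N a • S.one = S.mul a (S.mul a a)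
  rw [S.mul_self hT, S.mul_sharp hT]

attribute [ext] HexagonalSystem

theorem eq_mixedSystem :
    letI := S.field hT
    letI := S.algebra hT
    haveI := S.charP_three hT
    S = mixedSystem F J fun a => ⟨S.N a, S.algebraMap_N hT a⟩ := by
  let _ := S.field hT
  let _ := S.algebra hT
  have := S.charP_three hT
  have hN (a : J) : ∃ t : F, algebraMap F J t = a ^ 3 := ⟨S.N a, S.algebraMap_N hT a⟩
  ext a b
  · exact (S.mul_self hT a).symm.trans (pow_two a).symm
  · exact (algebraMap F J).injective ((S.algebraMap_N hT a).trans (hN a).choose_spec.symm)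
  · exact LinearMap.congr_fun₂ hT a b
  · exact S.cross_eq_two_smul_mul hT a b
  · rfl

end TraceZero

end HexagonalSystem

/-! ### Short circuits in graphs -/

section Graph

open SimpleGraph

variable {V : Type*} {G : SimpleGraph V}

theorem egirth_le_length_add_length {u v : V} {p q : G.Walk u v} (hp : p.IsPath) (hq : q.IsPath)
    (hpq : p ≠ q) : G.egirth ≤ p.length + q.length := by
  let H : SimpleGraph V := fromEdgeSet {e | e ∈ p.edges ++ q.edges}
  have mem_H {e : Sym2 V} : e ∈ H.edgeSet ↔ e ∈ p.edges ++ q.edges := by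
    simp only [H, edgeSet_fromEdgeSet, Set.mem_sdiff, Set.mem_ofPred_eq, and_iff_left_iff_imp]
    rintro he hdiag
    exact G.not_isDiag_of_mem_edgeSet (by
      rcases List.mem_append.1 he with h | h
      exacts [p.edges_subset_edgeSet h, q.edges_subset_edgeSet h]) hdiag
  have hpH : ∀ e ∈ p.edges, e ∈ H.edgeSet := fun e he => mem_H.2 (List.mem_append_left _ he)
  have hqH : ∀ e ∈ q.edges, e ∈ H.edgeSet := fun e he => mem_H.2 (List.mem_append_right _ he)
  have hHG : H ≤ G := by
    rw [← edgeSet_subset_edgeSet]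
    intro e he
    rcases List.mem_append.1 (mem_H.1 he) with h | h
    exacts [p.edges_subset_edgeSet h, q.edges_subset_edgeSet h]
  have hH : ¬ H.IsAcyclic := fun hac => hpq <| by
    have heq := (hac.subsingleton_path u v).elim ⟨_, hp.transfer hpH⟩ ⟨_, hq.transfer hqH⟩
    have hsupport := congrArg (fun r : H.Path u v => r.1.support) heq
    simp only [Walk.support_transfer] at hsupport
    exact Walk.ext_support hsupport
  obtain ⟨w, r, hr⟩ : ∃ w, ∃ r : H.Walk w w, r.IsCycle := by
    simpa [IsAcyclic] using hH
  have hlen : r.length ≤ (p.edges ++ q.edges).length := by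
    rw [← r.length_edges]
    exact (hr.edges_nodup.subperm fun e he => mem_H.1 (r.edges_subset_edgeSet he)).length_le
  calc G.egirth ≤ (r.mapLe hHG).length := egirth_le_length (hr.mapLe hHG)
    _ ≤ p.length + q.length := by
      rw [Walk.length_map]
      exact_mod_cast hlen.trans (by simp)

theorem eq_of_adj_of_dist_add_one_eq (hG : G.Connected) {v x y₁ y₂ : V}
    (hx : (2 * G.dist v x : ℕ) < G.egirth) (h₁ : G.Adj x y₁) (h₂ : G.Adj x y₂)
    (d₁ : G.dist v y₁ + 1 = G.dist v x) (d₂ : G.dist v y₂ + 1 = G.dist v x) : y₁ = y₂ := by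
  have geodesic {y : V} (h : G.Adj x y) (d : G.dist v y + 1 = G.dist v x) :
      ∃ p : G.Walk v x, p.IsPath ∧ p.length = G.dist v x ∧ p.penultimate = y := by
    obtain ⟨p, hp⟩ := hG.exists_walk_length_eq_dist v y
    have hlen : (p.concat h.symm).length = G.dist v x := by rw [Walk.length_concat, hp, d]
    exact ⟨p.concat h.symm, Walk.isPath_of_length_eq_dist _ hlen, hlen, p.penultimate_concat _⟩
  obtain ⟨p, hp, lp, rfl⟩ := geodesic h₁ d₁
  obtain ⟨q, hq, lq, rfl⟩ := geodesic h₂ d₂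
  by_contra hne
  refine hx.not_ge ((egirth_le_length_add_length hp hq fun h => hne (by rw [h])).trans ?_)
  rw [lp, lq, two_mul, Nat.cast_add]

theorem exists_adj_dist_add_one_eq (hG : G.Connected) {v x : V} (hne : v ≠ x) :
    ∃ y, G.Adj x y ∧ G.dist v y + 1 = G.dist v x := by
  obtain ⟨p, hp⟩ := hG.exists_walk_length_eq_dist x v
  cases p with
  | nil => exact absurd rfl hne
  | @cons _ y _ h p =>
    refine ⟨y, h, ?_⟩
    have hle : G.dist v y ≤ p.length := dist_comm (G := G) ▸ dist_le p
    have hdiff := h.diff_dist_adj (u := v)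
    rw [Walk.length_cons, dist_comm] at hp
    omega

theorem dist_eq_add_one_or_of_adj (hG : G.Connected) (C : G.Coloring Bool) (v : V) {x y : V}
    (h : G.Adj x y) : G.dist v y = G.dist v x + 1 ∨ G.dist v x = G.dist v y + 1 := by
  have hne : G.dist v y ≠ G.dist v x := fun heq => by
    obtain ⟨p, hp⟩ := hG.exists_walk_length_eq_dist v x
    obtain ⟨q, hq⟩ := hG.exists_walk_length_eq_dist v y
    have hxy := (C.even_length_iff_congr p).symm.trans
      ((by rw [hp, hq, heq] : Even p.length ↔ Even q.length).trans (C.even_length_iff_congr q))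
    exact C.valid h (Bool.eq_iff_iff.2 (by tauto))
  have hdiff := h.diff_dist_adj (u := v)
  omega

end Graph

namespace PointLineGeometry

open scoped commutatorElement

variable {P : Type w} {L : Type z} {Γ : PointLineGeometry P L}

/-! ### Collineations acting on the incidence graph -/

namespace Collineation

instance : MulAction Γ.Collineation (P ⊕ L) where
  smul g := g.act
  one_smul y := by cases y <;> rfl
  mul_smul g h y := by cases y <;> rfl

instance : FaithfulSMul Γ.Collineation (P ⊕ L) where
  eq_of_smul_eq_smul hgh := Subtype.ext <| Prod.ext
    (Equiv.ext fun p => Sum.inl_injective (hgh (Sum.inl p)))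
    (Equiv.ext fun l => Sum.inr_injective (hgh (Sum.inr l)))

@[simp]
theorem adj_smul_iff (g : Γ.Collineation) {x y : P ⊕ L} :
    Γ.incGraph.Adj (g • x) (g • y) ↔ Γ.incGraph.Adj x y := by
  have adj_smul (g : Γ.Collineation) {x y : P ⊕ L} (h : Γ.incGraph.Adj x y) :
      Γ.incGraph.Adj (g • x) (g • y) := by
    rcases h with ⟨p, l, rfl, rfl, h⟩ | ⟨p, l, rfl, rfl, h⟩
    · exact Or.inl ⟨_, _, rfl, rfl, (g.2 p l).2 h⟩
    · exact Or.inr ⟨_, _, rfl, rfl, (g.2 p l).2 h⟩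
  exact ⟨fun h => by simpa only [inv_smul_smul] using adj_smul g⁻¹ h, adj_smul g⟩

@[simp]
theorem dist_smul (g : Γ.Collineation) (x y : P ⊕ L) :
    Γ.incGraph.dist (g • x) (g • y) = Γ.incGraph.dist x y := by
  have edist_smul_le (g : Γ.Collineation) (x y : P ⊕ L) :
      Γ.incGraph.edist (g • x) (g • y) ≤ Γ.incGraph.edist x y :=
    le_iInf fun p => by
      let f : Γ.incGraph →g Γ.incGraph := ⟨(g • ·), g.adj_smul_iff.2⟩
      rw [← SimpleGraph.Walk.length_map f p]
      exact SimpleGraph.edist_le (p.map f)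
  have hle := edist_smul_le g⁻¹ (g • x) (g • y)
  rw [inv_smul_smul, inv_smul_smul] at hle
  rw [SimpleGraph.dist, SimpleGraph.dist, (edist_smul_le g x y).antisymm hle]

end Collineation

/-! ### Distances in generalised hexagons -/

/-- The 2-colouring of the incidence graph by the type (point or line) of an element. -/
def typeColoring (Γ : PointLineGeometry P L) : Γ.incGraph.Coloring Bool :=
  SimpleGraph.Coloring.mk Sum.isLeft (by
    rintro x y (⟨p, l, rfl, rfl, -⟩ | ⟨p, l, rfl, rfl, -⟩) <;> simp)

namespace IsCircuit

variable {n : ℕ} {c : ZMod n → P ⊕ L}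

theorem adj_natCast (hc : Γ.IsCircuit n c) (i : ZMod n) (k : ℕ) :
    Γ.incGraph.Adj (c (i + k)) (c (i + (k + 1 : ℕ))) := by
  simpa only [Nat.cast_add, Nat.cast_one, add_assoc] using hc.2 (i + k)

theorem edist_le (hc : Γ.IsCircuit n c) (i : ZMod n) (k : ℕ) :
    Γ.incGraph.edist (c i) (c (i + k)) ≤ k := by
  induction k with
  | zero => simp
  | succ k ih =>
    have hadj := SimpleGraph.edist_eq_one_iff_adj.2 (hc.adj_natCast i k)
    refine SimpleGraph.edist_triangle.trans ((add_le_add ih hadj.le).trans_eq ?_)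
    norm_cast

end IsCircuit

theorem isCircuit_of_isCycle {x : P ⊕ L} {w : Γ.incGraph.Walk x x} (hw : w.IsCycle) :
    Γ.IsCircuit w.length fun j => w.getVert j.val := by
  have hlen := hw.three_le_length
  have : NeZero w.length := ⟨by omega⟩
  have : Fact (1 < w.length) := ⟨by omega⟩
  refine ⟨fun j j' hj => ?_, fun j => ?_⟩
  · have hmem (j : ZMod w.length) : j.val ≤ w.length - 1 := Nat.le_sub_one_of_lt j.val_lt
    exact ZMod.val_injective _ (hw.getVert_injOn' (hmem j) (hmem j') hj)
  · have hj : j.val < w.length := j.val_lt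
    have hadj := w.adj_getVert_succ hj
    change Γ.incGraph.Adj (w.getVert j.val) (w.getVert (j + 1).val)
    rw [ZMod.val_add, ZMod.val_one]
    rcases (show j.val + 1 ≤ w.length from hj).lt_or_eq with hlt | heq
    · rwa [Nat.mod_eq_of_lt hlt]
    · rw [heq, w.getVert_length] at hadj
      rwa [heq, Nat.mod_self, w.getVert_zero]

namespace IsGeneralizedHexagon

variable (hΓ : Γ.IsGeneralizedHexagon)
include hΓ

theorem twelve_le_egirth : 12 ≤ Γ.incGraph.egirth := by
  refine SimpleGraph.le_egirth.2 fun x w hw => ?_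
  by_contra! hlt
  obtain ⟨k, hk⟩ := (Γ.typeColoring.even_length_iff_congr w).2 Iff.rfl
  rw [← two_mul] at hk
  have h12 : w.length < 12 := by exact_mod_cast hlt
  have h3 := hw.three_le_length
  have hcircuit := isCircuit_of_isCycle hw
  rw [hk] at hcircuit
  exact hΓ.no_small_polygon k (by omega) (by omega) _ hcircuit

theorem edist_le_six (x y : P ⊕ L) : Γ.incGraph.edist x y ≤ 6 := by
  obtain ⟨c, hc, ⟨i, rfl⟩, ⟨j, rfl⟩⟩ := hΓ.exists_apartment x y
  have key (i j : ZMod 12) (h : (j - i).val ≤ 6) : Γ.incGraph.edist (c i) (c j) ≤ 6 := by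
    have hle := IsCircuit.edist_le hc i (j - i).val
    rw [ZMod.natCast_zmod_val, add_sub_cancel] at hle
    exact hle.trans (by exact_mod_cast h)
  have hval : ∀ k : ZMod 12, k.val ≤ 6 ∨ (-k).val ≤ 6 := by decide
  rcases hval (j - i) with h | h
  · exact key i j h
  · rw [SimpleGraph.edist_comm]
    exact key j i (neg_sub j i ▸ h)

theorem connected : Γ.incGraph.Connected :=
  haveI := hΓ.nonempty
  ⟨fun x y => SimpleGraph.reachable_of_edist_ne_top
    ((hΓ.edist_le_six x y).trans_lt (by decide)).ne⟩

theorem edist_le_iff {x y : P ⊕ L} {n : ℕ} :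
    Γ.incGraph.edist x y ≤ n ↔ Γ.incGraph.dist x y ≤ n := by
  rw [← (hΓ.connected x y).coe_dist_eq_edist, Nat.cast_le]

theorem dist_le_six (x y : P ⊕ L) : Γ.incGraph.dist x y ≤ 6 :=
  hΓ.edist_le_iff.1 (hΓ.edist_le_six x y)

theorem dist_eq_or {x y : P ⊕ L} (v : P ⊕ L) (h : Γ.incGraph.Adj x y) :
    Γ.incGraph.dist v y = Γ.incGraph.dist v x + 1 ∨
      Γ.incGraph.dist v x = Γ.incGraph.dist v y + 1 :=
  dist_eq_add_one_or_of_adj hΓ.connected Γ.typeColoring v h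

theorem closer_unique {v x y₁ y₂ : P ⊕ L} (hx : Γ.incGraph.dist v x ≤ 5)
    (h₁ : Γ.incGraph.Adj x y₁) (h₂ : Γ.incGraph.Adj x y₂)
    (d₁ : Γ.incGraph.dist v y₁ + 1 = Γ.incGraph.dist v x)
    (d₂ : Γ.incGraph.dist v y₂ + 1 = Γ.incGraph.dist v x) : y₁ = y₂ := by
  refine eq_of_adj_of_dist_add_one_eq hΓ.connected (lt_of_lt_of_le ?_ hΓ.twelve_le_egirth)
    h₁ h₂ d₁ d₂
  exact_mod_cast (by omega : 2 * Γ.incGraph.dist v x < 12)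

theorem dist_eq_succ {v x y y' : P ⊕ L} (hx : Γ.incGraph.dist v x ≤ 5)
    (h : Γ.incGraph.Adj x y) (h' : Γ.incGraph.Adj x y')
    (d : Γ.incGraph.dist v y + 1 = Γ.incGraph.dist v x) (hne : y' ≠ y) :
    Γ.incGraph.dist v y' = Γ.incGraph.dist v x + 1 :=
  (hΓ.dist_eq_or v h').resolve_right fun e => hne (hΓ.closer_unique hx h' h e.symm d)

theorem dist_apartment {c : ZMod 12 → P ⊕ L} (hc : Γ.IsApartment c) (i : ZMod 12) {n : ℕ}
    (hn : n ≤ 6) : Γ.incGraph.dist (c i) (c (i + n)) = n := by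
  induction n using Nat.twoStepInduction with
  | zero => simp
  | one => simpa only [Nat.cast_one] using SimpleGraph.dist_eq_one_iff_adj.2 (hc.2 i)
  | more n ih ih' =>
    have hne : c (i + (n + 2 : ℕ)) ≠ c (i + n) := fun h => by
      have h2 : (2 : ZMod 12) = 0 := by simpa using hc.1 h
      exact absurd h2 (by decide)
    have dn := ih (by omega)
    have dn' := ih' (by omega)
    have d := hΓ.dist_eq_succ (v := c i) (by omega) (IsCircuit.adj_natCast hc i n).symm
      (IsCircuit.adj_natCast hc i (n + 1)) (by omega) hne
    rwa [dn'] at d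

theorem eq_of_apartments {c c' : ZMod 12 → P ⊕ L} (hc : Γ.IsApartment c)
    (hc' : Γ.IsApartment c') {i : ZMod 12} {n : ℕ} (hn : n ≤ 5) (h₀ : c i = c' i)
    (hn₀ : c (i + n) = c' (i + n)) {k : ℕ} (hk : k ≤ n) : c (i + k) = c' (i + k) := by
  induction n generalizing k with
  | zero => simpa [Nat.le_zero.1 hk] using h₀
  | succ n ih =>
    have hadj := IsCircuit.adj_natCast hc i n
    have hadj' := IsCircuit.adj_natCast hc' i n
    have d := hΓ.dist_apartment hc i (n := n) (by omega)
    have d' := hΓ.dist_apartment hc' i (n := n) (by omega)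
    have dn := hΓ.dist_apartment hc i (n := n + 1) (by omega)
    rw [← hn₀] at hadj'
    rw [← h₀] at d'
    have hpred : c (i + n) = c' (i + n) :=
      hΓ.closer_unique (v := c i) (by omega) hadj.symm hadj'.symm (by omega) (by omega)
    rcases hk.lt_or_eq with hlt | rfl
    · exact ih (by omega) hpred (by omega)
    · exact hn₀

end IsGeneralizedHexagon

theorem IsThick.exists_adj_ne (ht : Γ.IsThick) (x a b : P ⊕ L) :
    ∃ y, Γ.incGraph.Adj x y ∧ y ≠ a ∧ y ≠ b := by
  by_contra! hcon
  have hsub : Γ.incGraph.neighborSet x ⊆ {a, b} := fun y hy =>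
    or_iff_not_imp_left.2 (hcon y hy)
  have hle := ((ht x).trans (Set.encard_le_encard hsub)).trans (Set.encard_insert_le {b} a)
  rw [Set.encard_singleton, one_add_one_eq_two] at hle
  exact absurd hle (by decide)

namespace IsGeneralizedHexagon

variable (hΓ : Γ.IsGeneralizedHexagon) (ht : Γ.IsThick)
include hΓ ht

theorem exists_dist_eq_add (v x : P ⊕ L) {k : ℕ} (hk : Γ.incGraph.dist v x + k ≤ 6) :
    ∃ y, Γ.incGraph.dist x y ≤ k ∧ Γ.incGraph.dist v y = Γ.incGraph.dist v x + k := by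
  induction k with
  | zero => exact ⟨x, by simp, rfl⟩
  | succ k ih =>
    obtain ⟨y, hxy, hvy⟩ := ih (by omega)
    suffices ∃ z, Γ.incGraph.Adj y z ∧ Γ.incGraph.dist v z = Γ.incGraph.dist v y + 1 by
      obtain ⟨z, hyz, hvz⟩ := this
      have hxz := hΓ.dist_eq_or x hyz
      exact ⟨z, by omega, by omega⟩
    by_cases hne : v = y
    · obtain ⟨z, hz, -⟩ := ht.exists_adj_ne y y y
      refine ⟨z, hz, ?_⟩
      rw [hne, SimpleGraph.dist_self, SimpleGraph.dist_eq_one_iff_adj.2 hz]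
    · obtain ⟨e, he, hve⟩ := exists_adj_dist_add_one_eq hΓ.connected hne
      obtain ⟨z, hz, hze, -⟩ := ht.exists_adj_ne y e e
      exact ⟨z, hz, hΓ.dist_eq_succ (by omega) he hz hve hze⟩

theorem exists_adj_opposite_both {x y v : P ⊕ L} (hx : Γ.incGraph.dist x v = 5)
    (hy : Γ.incGraph.dist y v = 5) :
    ∃ z, Γ.incGraph.Adj v z ∧ Γ.incGraph.dist x z = 6 ∧ Γ.incGraph.dist y z = 6 := by
  have hxv : x ≠ v := by rintro rfl; simp at hx
  have hyv : y ≠ v := by rintro rfl; simp at hy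
  obtain ⟨a, ha, hxa⟩ := exists_adj_dist_add_one_eq hΓ.connected hxv
  obtain ⟨b, hb, hyb⟩ := exists_adj_dist_add_one_eq hΓ.connected hyv
  obtain ⟨z, hz, hza, hzb⟩ := ht.exists_adj_ne v a b
  have hxz := hΓ.dist_eq_succ hx.le ha hz hxa hza
  have hyz := hΓ.dist_eq_succ hy.le hb hz hyb hzb
  exact ⟨z, hz, by omega, by omega⟩

end IsGeneralizedHexagon

/-! ### Pointwise stabilisers of balls and rigidity -/

/-- The group `G_x^{[r]}` of collineations fixing every element at distance at most `r` from `x`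
in the incidence graph. -/
def ballFixer (Γ : PointLineGeometry P L) (x : P ⊕ L) (r : ℕ) : Subgroup Γ.Collineation :=
  fixingSubgroup Γ.Collineation {y | Γ.incGraph.dist x y ≤ r}

section ballFixer

variable {θ g : Γ.Collineation} {x : P ⊕ L} {r : ℕ}

theorem mem_ballFixer :
    θ ∈ Γ.ballFixer x r ↔ ∀ y, Γ.incGraph.dist x y ≤ r → θ • y = y :=
  mem_fixingSubgroup_iff _

theorem smul_center_of_mem_ballFixer (h : θ ∈ Γ.ballFixer x r) : θ • x = x :=
  mem_ballFixer.1 h x (by simp)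

theorem conj_mem_ballFixer (h : θ ∈ Γ.ballFixer x r) (g : Γ.Collineation) :
    g * θ * g⁻¹ ∈ Γ.ballFixer (g • x) r := by
  refine mem_ballFixer.2 fun y hy => ?_
  rw [mul_smul, mul_smul, mem_ballFixer.1 h, smul_inv_smul]
  rwa [← g.dist_smul, smul_inv_smul]

theorem mem_ballFixer_smul_of_commute (h : θ ∈ Γ.ballFixer x r) (hg : Commute g θ) :
    θ ∈ Γ.ballFixer (g • x) r := by
  simpa only [hg.eq, mul_inv_cancel_right] using conj_mem_ballFixer h g

theorem commutatorElement_mem_ballFixer (h : θ ∈ Γ.ballFixer x r) (hg : g • x = x) :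
    ⁅g, θ⁆ ∈ Γ.ballFixer x r := by
  rw [commutatorElement_def]
  exact mul_mem (hg ▸ conj_mem_ballFixer h g) (inv_mem h)

end ballFixer

namespace IsGeneralizedHexagon

section Distance

variable (hΓ : Γ.IsGeneralizedHexagon) {θ : Γ.Collineation} {x y : P ⊕ L} {r s : ℕ}
include hΓ

theorem mem_ballFixer_of_dist_add_le (h : θ ∈ Γ.ballFixer x r)
    (hs : Γ.incGraph.dist x y + s ≤ r) : θ ∈ Γ.ballFixer y s := by
  refine mem_ballFixer.2 fun z hz => mem_ballFixer.1 h z ?_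
  have := hΓ.connected.dist_triangle (u := x) (v := y) (w := z)
  omega

theorem mem_ballFixer_succ (hx : θ • x = x)
    (h : ∀ y, Γ.incGraph.Adj x y → θ ∈ Γ.ballFixer y r) : θ ∈ Γ.ballFixer x (r + 1) := by
  refine mem_ballFixer.2 fun y hy => ?_
  by_cases hyx : y = x
  · rw [hyx, hx]
  · obtain ⟨z, hz, hyz⟩ := exists_adj_dist_add_one_eq hΓ.connected hyx
    rw [SimpleGraph.dist_comm, SimpleGraph.dist_comm (v := x)] at hyz
    exact mem_ballFixer.1 (h z hz) y (by omega)

theorem mem_ballFixer_one :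
    θ ∈ Γ.ballFixer x 1 ↔ θ • x = x ∧ ∀ y, Γ.incGraph.Adj x y → θ • y = y := by
  refine ⟨fun h => ⟨smul_center_of_mem_ballFixer h, fun y hy => mem_ballFixer.1 h y
    (SimpleGraph.dist_eq_one_iff_adj.2 hy).le⟩, fun h => hΓ.mem_ballFixer_succ h.1 fun y hy =>
    mem_ballFixer.2 fun z hz => ?_⟩
  rw [← hΓ.connected.dist_eq_zero_iff.1 (Nat.le_zero.1 hz)]
  exact h.2 y hy

theorem smul_closer {v : P ⊕ L} (hv : θ • v = v) (hx : θ • x = x)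
    (hd : Γ.incGraph.dist v x ≤ 5) (hy : Γ.incGraph.Adj x y)
    (hvy : Γ.incGraph.dist v y + 1 = Γ.incGraph.dist v x) : θ • y = y := by
  have hadj := θ.adj_smul_iff.2 hy
  have hdist := θ.dist_smul v y
  rw [hx] at hadj
  rw [hv] at hdist
  exact hΓ.closer_unique hd hadj hy (by omega) hvy

theorem mem_ballFixer_one_of_opposite (hx : θ ∈ Γ.ballFixer x 1) (hy : θ • y = y)
    (hd : Γ.incGraph.dist x y = 6) : θ ∈ Γ.ballFixer y 1 := by
  refine hΓ.mem_ballFixer_one.2 ⟨hy, fun z hz => ?_⟩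
  have hle := hΓ.dist_le_six x z
  have h5 : Γ.incGraph.dist x z = 5 := by
    have hxz := hΓ.dist_eq_or x hz
    omega
  obtain ⟨x', hx', hzx'⟩ := exists_adj_dist_add_one_eq hΓ.connected
    (v := z) (x := x) (by rintro rfl; simp at h5)
  have hyx' := hΓ.dist_eq_or y hx'
  have hle' := hΓ.dist_le_six y x'
  have hz' := hΓ.dist_eq_or x' hz
  rw [SimpleGraph.dist_comm, SimpleGraph.dist_comm (v := x)] at hzx'
  rw [SimpleGraph.dist_comm (u := y), SimpleGraph.dist_comm (u := y)] at hyx'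
  rw [SimpleGraph.dist_comm] at hle'
  exact hΓ.smul_closer ((hΓ.mem_ballFixer_one.1 hx).2 x' hx') hy (by omega) hz (by omega)

end Distance

section Thick

variable (hΓ : Γ.IsGeneralizedHexagon) (ht : Γ.IsThick) {θ : Γ.Collineation}
include hΓ ht

/-- The hypotheses are reproduced at `z`, so they propagate along paths. -/
theorem mem_ballFixer_one_of_adj {v w v' z : P ⊕ L} (hv : θ ∈ Γ.ballFixer v 1)
    (hw : θ ∈ Γ.ballFixer w 1) (hvw : Γ.incGraph.Adj v w) (hv' : θ • v' = v')
    (hd : Γ.incGraph.dist v v' = 6) (hz : Γ.incGraph.Adj v z) :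
    θ ∈ Γ.ballFixer z 1 ∧ ∃ z', θ • z' = z' ∧ Γ.incGraph.dist z z' = 6 := by
  have dist_eq_five {z : P ⊕ L} (hz : Γ.incGraph.Adj v z) : Γ.incGraph.dist z v' = 5 := by
    have hvz := hΓ.dist_eq_or v' hz
    have hle := hΓ.dist_le_six v' z
    rw [SimpleGraph.dist_comm (v := v), SimpleGraph.dist_comm (v := z)] at hvz
    rw [SimpleGraph.dist_comm] at hle
    omega
  obtain ⟨y, hy, hzy, hwy⟩ := hΓ.exists_adj_opposite_both ht (dist_eq_five hz) (dist_eq_five hvw)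
  have hy' : θ • y = y :=
    (hΓ.mem_ballFixer_one.1 (hΓ.mem_ballFixer_one_of_opposite hv hv' hd)).2 y hy
  have hyball := hΓ.mem_ballFixer_one_of_opposite hw hy' hwy
  refine ⟨hΓ.mem_ballFixer_one_of_opposite hyball ((hΓ.mem_ballFixer_one.1 hv).2 z hz) ?_,
    y, hy', hzy⟩
  rw [SimpleGraph.dist_comm, hzy]

theorem eq_one_of_mem_ballFixer_one {v w v' : P ⊕ L} (hv : θ ∈ Γ.ballFixer v 1)
    (hw : θ ∈ Γ.ballFixer w 1) (hvw : Γ.incGraph.Adj v w) (hv' : θ • v' = v')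
    (hd : Γ.incGraph.dist v v' = 6) : θ = 1 := by
  have fixes_end {x y : P ⊕ L} (p : Γ.incGraph.Walk x y) (hx : θ ∈ Γ.ballFixer x 1)
      (hnbr : ∃ w, Γ.incGraph.Adj x w ∧ θ ∈ Γ.ballFixer w 1)
      (hopp : ∃ x', θ • x' = x' ∧ Γ.incGraph.dist x x' = 6) : θ • y = y := by
    induction p with
    | nil => exact smul_center_of_mem_ballFixer hx
    | cons h _ ih =>
      obtain ⟨w, hxw, hw⟩ := hnbr
      obtain ⟨x', hx', hdx'⟩ := hopp
      obtain ⟨hz, hzopp⟩ := hΓ.mem_ballFixer_one_of_adj ht hx hw hxw hx' hdx' h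
      exact ih hz ⟨_, h.symm, hx⟩ hzopp
  refine FaithfulSMul.eq_of_smul_eq_smul fun y : P ⊕ L => ?_
  obtain ⟨p⟩ := hΓ.connected v y
  rw [one_smul]
  exact fixes_end p hv ⟨w, hvw, hw⟩ ⟨v', hv', hd⟩

theorem eq_one_of_mem_ballFixer_three {l x : P ⊕ L} (hl : θ ∈ Γ.ballFixer l 3) (hx : θ • x = x)
    (hd : 4 ≤ Γ.incGraph.dist l x) : θ = 1 := by
  have hle := hΓ.dist_le_six l x
  have hcomm := SimpleGraph.dist_comm (G := Γ.incGraph) (u := l) (v := x)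
  obtain ⟨v, hlv, hxv⟩ := hΓ.exists_dist_eq_add ht x l
    (k := 6 - Γ.incGraph.dist x l) (by omega)
  obtain ⟨w, hvw, hlw⟩ : ∃ w, Γ.incGraph.Adj v w ∧ Γ.incGraph.dist l w ≤ 2 := by
    by_cases hne : l = v
    · obtain ⟨w, hw, -⟩ := ht.exists_adj_ne v v v
      exact ⟨w, hw, by rw [hne, SimpleGraph.dist_eq_one_iff_adj.2 hw]; norm_num⟩
    · obtain ⟨w, hw, hlw⟩ := exists_adj_dist_add_one_eq hΓ.connected hne
      exact ⟨w, hw, by omega⟩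
  refine hΓ.eq_one_of_mem_ballFixer_one ht (hΓ.mem_ballFixer_of_dist_add_le hl (y := v) ?_)
    (hΓ.mem_ballFixer_of_dist_add_le hl (y := w) ?_) hvw hx ?_
  · omega
  · omega
  · rw [SimpleGraph.dist_comm]
    omega

theorem smul_eq_self_iff_of_mem_ballFixer_three {l : P ⊕ L} (hl : θ ∈ Γ.ballFixer l 3)
    (hne : θ ≠ 1) (x : P ⊕ L) : θ • x = x ↔ Γ.incGraph.dist l x ≤ 3 := by
  refine ⟨fun hx => ?_, mem_ballFixer.1 hl x⟩
  by_contra! hlt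
  exact hne (hΓ.eq_one_of_mem_ballFixer_three ht hl hx hlt)

theorem commute_of_mem_ballFixer_three {θ' : Γ.Collineation} {l l' : P ⊕ L}
    (hl : θ ∈ Γ.ballFixer l 3) (hl' : θ' ∈ Γ.ballFixer l' 3) (hne : l ≠ l')
    (hd : Γ.incGraph.dist l l' ≤ 3) : Commute θ θ' := by
  have hfix : ⁅θ, θ'⁆ ∈ Γ.ballFixer l 3 := by
    rw [← commutatorElement_inv]
    refine inv_mem (commutatorElement_mem_ballFixer hl (mem_ballFixer.1 hl' l ?_))
    rwa [SimpleGraph.dist_comm]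
  have hfix' : ⁅θ, θ'⁆ ∈ Γ.ballFixer l' 3 :=
    commutatorElement_mem_ballFixer hl' (mem_ballFixer.1 hl l' hd)
  have hpos := hΓ.connected.pos_dist_of_ne hne
  obtain ⟨x, hl'x, hlx⟩ := hΓ.exists_dist_eq_add ht l l' (k := 3) (by omega)
  exact commutatorElement_eq_one_iff_commute.1
    (hΓ.eq_one_of_mem_ballFixer_three ht hfix (mem_ballFixer.1 hfix' x hl'x) (by omega))

end Thick

end IsGeneralizedHexagon

/-! ### Root groups -/

section rootGroup

variable {c : ZMod 12 → P ⊕ L} {i : ZMod 12} {θ : Γ.Collineation}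

theorem IsApartment.smul_of_mem_rootGroup (hc : Γ.IsApartment c) (h : θ ∈ Γ.rootGroup c i)
    {k : ℕ} (hk : k ≤ 6) : θ • c (i + k) = c (i + k) := by
  rcases le_or_gt k 4 with h4 | h4
  · exact h (k + 1) (by omega) (by omega) _ (IsCircuit.adj_natCast hc i k).symm
  · obtain ⟨m, rfl⟩ : ∃ m, k = m + 1 := ⟨k - 1, by omega⟩
    exact h m (by omega) (by omega) _ (IsCircuit.adj_natCast hc i m)

namespace IsGeneralizedHexagon

variable (hΓ : Γ.IsGeneralizedHexagon) (hc : Γ.IsApartment c)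
include hΓ hc

theorem mem_rootGroup_iff :
    θ ∈ Γ.rootGroup c i ↔ ∀ k : ℕ, 1 ≤ k → k ≤ 5 → θ ∈ Γ.ballFixer (c (i + k)) 1 :=
  ⟨fun h k h1 h5 =>
    hΓ.mem_ballFixer_one.2 ⟨hc.smul_of_mem_rootGroup h (by omega), h k h1 h5⟩,
  fun h k h1 h5 => (hΓ.mem_ballFixer_one.1 (h k h1 h5)).2⟩

theorem eq_one_of_mem_rootGroup (ht : Γ.IsThick) (h : θ ∈ Γ.rootGroup c i)
    (h7 : θ • c (i + 7) = c (i + 7)) : θ = 1 := by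
  have hball := (hΓ.mem_rootGroup_iff hc).1 h
  refine hΓ.eq_one_of_mem_ballFixer_one ht (hball 1 le_rfl (by norm_num))
    (hball 2 (by norm_num) (by norm_num)) (IsCircuit.adj_natCast hc i 1) h7 ?_
  convert hΓ.dist_apartment hc (i + (1 : ℕ)) (n := 6) le_rfl using 3
  push_cast
  ring

theorem rootGroup_ext (ht : Γ.IsThick) {θ' : Γ.Collineation} (h : θ ∈ Γ.rootGroup c i)
    (h' : θ' ∈ Γ.rootGroup c i) (h7 : θ • c (i + 7) = θ' • c (i + 7)) : θ = θ' := by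
  refine (inv_mul_eq_one.1 (hΓ.eq_one_of_mem_rootGroup hc ht (mul_mem (inv_mem h') h) ?_)).symm
  rw [mul_smul, h7, inv_smul_smul]

theorem ballFixer_three_le_rootGroup : Γ.ballFixer (c (i + 3)) 3 ≤ Γ.rootGroup c i := by
  refine fun θ h => (hΓ.mem_rootGroup_iff hc).2 fun k h1 h5 =>
    hΓ.mem_ballFixer_of_dist_add_le h ?_
  rcases le_total k 3 with h3 | h3
  · have hd := hΓ.dist_apartment hc (i + k) (n := 3 - k) (by omega)
    rw [Nat.cast_sub h3, Nat.cast_ofNat, add_assoc, add_sub_cancel, SimpleGraph.dist_comm] at hd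
    omega
  · have hd := hΓ.dist_apartment hc (i + 3) (n := k - 3) (by omega)
    rw [Nat.cast_sub h3, Nat.cast_ofNat, add_assoc, add_sub_cancel] at hd
    omega

end IsGeneralizedHexagon

end rootGroup

/-! ### Reflections of apartments -/

section Apartment

variable {c : ZMod 12 → P ⊕ L}

theorem IsApartment.smul (hc : Γ.IsApartment c) (g : Γ.Collineation) :
    Γ.IsApartment fun j => g • c j :=
  ⟨(MulAction.injective g).comp hc.1, fun j => g.adj_smul_iff.2 (hc.2 j)⟩

theorem IsApartment.reverse (hc : Γ.IsApartment c) (i : ZMod 12) :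
    Γ.IsApartment fun j => c (i - j) := by
  refine ⟨hc.1.comp sub_right_injective, fun j => ?_⟩
  convert (hc.2 (i - (j + 1))).symm using 2
  ring

theorem conj_mem_rootGroup {i : ZMod 12} {θ : Γ.Collineation} (hθ : θ ∈ Γ.rootGroup c i)
    (g : Γ.Collineation) : g * θ * g⁻¹ ∈ Γ.rootGroup (fun j => g • c j) i := by
  intro k h1 h5 y hy
  change (g * θ * g⁻¹) • y = y
  have hθy : θ • g⁻¹ • y = g⁻¹ • y :=
    hθ k h1 h5 _ (g.adj_smul_iff.1 (by rwa [smul_inv_smul]))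
  rw [mul_smul, mul_smul, hθy, smul_inv_smul]

theorem rootGroup_reverse (Γ : PointLineGeometry P L) (c : ZMod 12 → P ⊕ L) (i k : ZMod 12) :
    Γ.rootGroup (fun j => c (i - j)) k = Γ.rootGroup c (i - k - 6) := by
  have index {n : ℕ} (h5 : n ≤ 5) : i - k - 6 + ((6 - n : ℕ) : ZMod 12) = i - (k + n) := by
    rw [Nat.cast_sub (by omega)]
    push_cast
    ring
  ext θ
  constructor
  · intro h n h1 h5 y hy
    have hn := index (n := 6 - n) (by omega)
    rw [Nat.sub_sub_self (by omega)] at hn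
    exact h (6 - n) (by omega) (by omega) y (show Γ.incGraph.Adj (c (i - _)) y from hn ▸ hy)
  · intro h n h1 h5 y hy
    exact h (6 - n) (by omega) (by omega) y ((index h5).symm ▸ hy)

theorem conj_mem_rootGroup_of_reflection {i k : ZMod 12} {g θ : Γ.Collineation}
    (hg : ∀ j, g • c j = c (i - j)) (hθ : θ ∈ Γ.rootGroup c k) :
    g * θ * g⁻¹ ∈ Γ.rootGroup c (i - k - 6) := by
  rw [← rootGroup_reverse, ← funext hg]
  exact conj_mem_rootGroup hθ g

theorem IsCircuit.isLeft_eq_iff_even {n : ℕ} {c : ZMod n → P ⊕ L} (hc : Γ.IsCircuit n c)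
    (i : ZMod n) (k : ℕ) : (c (i + k)).isLeft = (c i).isLeft ↔ Even k := by
  induction k with
  | zero => simp
  | succ k ih =>
    have hne : (c (i + k)).isLeft ≠ (c (i + (k + 1 : ℕ))).isLeft :=
      Γ.typeColoring.valid (hc.adj_natCast i k)
    rw [Nat.even_add_one, ← ih]
    revert hne
    cases (c (i + k)).isLeft <;> cases (c (i + (k + 1 : ℕ))).isLeft <;> simp

end Apartment

namespace IsGeneralizedHexagon

variable (hΓ : Γ.IsGeneralizedHexagon) {c : ZMod 12 → P ⊕ L} (hc : Γ.IsApartment c)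
include hΓ hc

theorem apartment_ext {c' : ZMod 12 → P ⊕ L} (hc' : Γ.IsApartment c') {i : ZMod 12}
    (h₀ : c i = c' i) (h₅ : c (i + 5) = c' (i + 5)) (h₆ : c (i + 6) = c' (i + 6))
    (h₇ : c (i + 7) = c' (i + 7)) : c = c' := by
  have h12 (i : ZMod 12) : i + 7 + ((5 : ℕ) : ZMod 12) = i := by
    rw [add_assoc]
    exact add_eq_left.2 rfl
  have hnat : ∀ k < 12, c (i + (k : ℕ)) = c' (i + (k : ℕ)) := by
    intro k hk
    rcases lt_trichotomy k 6 with h | rfl | h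
    · exact hΓ.eq_of_apartments hc hc' le_rfl h₀ h₅ (Nat.le_of_lt_succ h)
    · exact h₆
    · obtain ⟨m, rfl⟩ := Nat.exists_eq_add_of_le (Nat.succ_le_of_lt h)
      rw [Nat.cast_add, ← add_assoc]
      exact hΓ.eq_of_apartments hc hc' le_rfl h₇ (by rwa [h12]) (by omega)
  funext j
  simpa only [ZMod.natCast_zmod_val, add_sub_cancel] using hnat (j - i).val (ZMod.val_lt _)

theorem smul_eq_reflection {i : ZMod 12} {g : Γ.Collineation} (h₀ : g • c i = c i)
    (h₅ : g • c (i + 5) = c (i + 7)) (h₆ : g • c (i + 6) = c (i + 6))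
    (h₇ : g • c (i + 7) = c (i + 5)) (j : ZMod 12) : g • c j = c (2 * i - j) := by
  have e : ∀ i : ZMod 12, 2 * i - i = i ∧ 2 * i - (i + 5) = i + 7 ∧ 2 * i - (i + 6) = i + 6 ∧
    2 * i - (i + 7) = i + 5 := by decide
  obtain ⟨e₀, e₅, e₆, e₇⟩ := e i
  refine congrFun (hΓ.apartment_ext (hc.smul g) (hc.reverse (2 * i)) (i := i) ?_ ?_ ?_ ?_) j
  · rw [h₀, e₀]
  · rw [h₅, e₅]
  · rw [h₆, e₆]
  · rw [h₇, e₇]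

end IsGeneralizedHexagon

namespace IsMoufangHexagon

variable (hΓ : Γ.IsMoufangHexagon)
include hΓ

section Apartment

variable {c : ZMod 12 → P ⊕ L} (hc : Γ.IsApartment c)
include hc

theorem exists_mem_rootGroup_smul_eq (i : ZMod 12) {y y' : P ⊕ L}
    (hy : Γ.incGraph.Adj (c (i + 6)) y) (hne : y ≠ c (i + 5))
    (hy' : Γ.incGraph.Adj (c (i + 6)) y') (hne' : y' ≠ c (i + 5)) :
    ∃ θ ∈ Γ.rootGroup c i, θ • y = y' := by
  have e₀ : i + 6 - 0 = i + 6 := sub_zero _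
  have e₁ : i + 6 - (0 + 1) = i + 5 := by ring
  have eroot : i + 6 - 6 = i := add_sub_cancel_right i 6
  have hmoufang := hΓ.moufang _ (hc.reverse (i + 6)) 0 y y'
  rw [rootGroup_reverse, e₀, e₁, eroot] at hmoufang
  exact hmoufang hy hne hy' hne'

theorem exists_reflection_of_mem {i : ZMod 12} {x : Γ.Collineation}
    (hx : x ∈ Γ.rootGroup c i) (hne : x • c (i + 7) ≠ c (i + 7)) :
    ∃ y ∈ Γ.rootGroup c (i + 6), ∃ y' ∈ Γ.rootGroup c (i + 6),
      ∀ j, (y * x * y') • c j = c (2 * i - j) := by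
  have e : ∀ i : ZMod 12, i + 5 + 1 = i + 6 ∧ i + 6 + 1 = i + 7 ∧ i + 6 + 6 = i ∧
    i + 5 ≠ i + 7 := by decide
  obtain ⟨e₆, e₇, e₁₂, h57⟩ := e i
  have adj₅ : Γ.incGraph.Adj (c (i + 6)) (c (i + 5)) := (e₆ ▸ hc.2 (i + 5)).symm
  have adj₇ : Γ.incGraph.Adj (c (i + 6)) (c (i + 7)) := e₇ ▸ hc.2 (i + 6)
  have x₀ : x • c i = c i := by simpa using hc.smul_of_mem_rootGroup hx (Nat.zero_le 6)
  have x₆ : x • c (i + 6) = c (i + 6) := hc.smul_of_mem_rootGroup hx le_rfl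
  have x₆' : x⁻¹ • c (i + 6) = c (i + 6) := inv_smul_eq_iff.2 x₆.symm
  have fix₆ {y} (hy : y ∈ Γ.rootGroup c (i + 6)) : y • c (i + 6) = c (i + 6) := by
    simpa using hc.smul_of_mem_rootGroup hy (Nat.zero_le 6)
  have fix₇ {y} (hy : y ∈ Γ.rootGroup c (i + 6)) : y • c (i + 7) = c (i + 7) := by
    simpa [e₇] using hc.smul_of_mem_rootGroup hy (k := 1) (by norm_num)
  have fix₀ {y} (hy : y ∈ Γ.rootGroup c (i + 6)) : y • c i = c i := by
    simpa [e₁₂] using hc.smul_of_mem_rootGroup hy le_rfl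
  obtain ⟨y, hy, hyx⟩ : ∃ y ∈ Γ.rootGroup c (i + 6), y • x • c (i + 7) = c (i + 5) :=
    hΓ.moufang c hc (i + 6) _ _ (by simpa only [x₆] using x.adj_smul_iff.2 adj₇)
      (by rwa [e₇]) adj₅ (by rw [e₇]; exact hc.1.ne h57)
  obtain ⟨y', hy', hyx'⟩ : ∃ y' ∈ Γ.rootGroup c (i + 6), y' • c (i + 5) = x⁻¹ • c (i + 7) :=
    hΓ.moufang c hc (i + 6) _ _ adj₅ (by rw [e₇]; exact hc.1.ne h57)
      (by simpa only [x₆'] using x⁻¹.adj_smul_iff.2 adj₇)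
      (by rw [e₇]; exact fun h => hne (inv_smul_eq_iff.1 h).symm)
  refine ⟨y, hy, y', hy', hΓ.hexagon.smul_eq_reflection hc ?_ ?_ ?_ ?_⟩
  · rw [mul_smul, mul_smul, fix₀ hy', x₀, fix₀ hy]
  · rw [mul_smul, mul_smul, hyx', smul_inv_smul, fix₇ hy]
  · rw [mul_smul, mul_smul, fix₆ hy', x₆, fix₆ hy]
  · rw [mul_smul, mul_smul, fix₇ hy', hyx]

theorem exists_reflection (i : ZMod 12) :
    ∃ g : Γ.Collineation, ∀ j, g • c j = c (2 * i - j) := by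
  obtain ⟨y, hy, hy5, hy7⟩ := hΓ.thick.exists_adj_ne (c (i + 6)) (c (i + 5)) (c (i + 7))
  have h75 : ∀ i : ZMod 12, i + 7 ≠ i + 5 ∧ i + 6 + 1 = i + 7 := by decide
  obtain ⟨x, hx, hxy⟩ := hΓ.exists_mem_rootGroup_smul_eq hc i ((h75 i).2 ▸ hc.2 (i + 6))
    (hc.1.ne (h75 i).1) hy hy5
  obtain ⟨z, -, z', -, h⟩ := hΓ.exists_reflection_of_mem hc hx (hxy ▸ hy7)
  exact ⟨z * x * z', h⟩

end Apartment

theorem exists_smul_eq {x y : P ⊕ L} (h : x.isLeft = y.isLeft) :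
    ∃ g : Γ.Collineation, g • x = y := by
  obtain ⟨c, hc, ⟨i, rfl⟩, ⟨j, rfl⟩⟩ := hΓ.hexagon.exists_apartment x y
  have hij : i + ((j - i).val : ZMod 12) = j := by simp
  obtain ⟨k, hk⟩ := (IsCircuit.isLeft_eq_iff_even hc i (j - i).val).1 (by rw [hij, h])
  obtain ⟨g, hg⟩ := hΓ.exists_reflection hc (i + k)
  refine ⟨g, (hg i).trans (congrArg c ?_)⟩
  rw [← hij, hk]
  push_cast
  ring

end IsMoufangHexagon

/-! ### Root elations fixing a ball -/

theorem IsGeneralizedHexagon.mem_ballFixer_succ_of_commute (hΓ : Γ.IsGeneralizedHexagon)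
    {θ : Γ.Collineation} {x a b : P ⊕ L} {r : ℕ} (hx : θ • x = x) (ha : θ ∈ Γ.ballFixer a r)
    (hb : θ ∈ Γ.ballFixer b r)
    (hmove : ∀ y, Γ.incGraph.Adj x y → y ≠ a → ∃ u, Commute u θ ∧ u • b = y) :
    θ ∈ Γ.ballFixer x (r + 1) := by
  refine hΓ.mem_ballFixer_succ hx fun y hy => ?_
  by_cases hya : y = a
  · rwa [hya]
  · obtain ⟨u, hu, rfl⟩ := hmove y hy hya
    exact mem_ballFixer_smul_of_commute hb hu

theorem IsMoufangHexagon.mem_ballFixer_three_of_commute (hΓ : Γ.IsMoufangHexagon)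
    {c : ZMod 12 → P ⊕ L} (hc : Γ.IsApartment c) {i : ZMod 12} {θ : Γ.Collineation}
    (hθ : θ ∈ Γ.rootGroup c i) (hcomm : ∀ u ∈ Γ.rootGroup c (i - 2), Commute u θ)
    (hcomm₂ : ∀ u ∈ Γ.rootGroup c (i + 2), Commute u θ)
    (hcomm₃ : ∀ u ∈ Γ.rootGroup c (i + 3), Commute u θ) : θ ∈ Γ.ballFixer (c (i + 3)) 3 := by
  have e : ∀ i : ZMod 12, i + 2 + 1 = i + 3 ∧ i + 3 + 1 = i + 4 ∧ i - 2 + 6 = i + 4 ∧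
    i - 2 + 5 = i + 3 ∧ i + 4 + 1 = i + 5 ∧ i + 1 + 1 = i + 2 ∧ i + 1 ≠ i + 3 ∧ i + 5 ≠ i + 3 ∧
    i + 2 ≠ i + 4 := by decide
  obtain ⟨e₃, e₄, e₄', e₃', e₅, e₂, h13, h53, h24⟩ := e i
  have fix (k : ℕ) (hk : k ≤ 6) : θ • c (i + k) = c (i + k) := hc.smul_of_mem_rootGroup hθ hk
  have ball (k : ℕ) (h1 : 1 ≤ k) (h5 : k ≤ 5) : θ ∈ Γ.ballFixer (c (i + k)) 1 :=
    (hΓ.hexagon.mem_rootGroup_iff hc).1 hθ k h1 h5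
  have ball₂ : θ ∈ Γ.ballFixer (c (i + 2)) 2 := by
    refine hΓ.hexagon.mem_ballFixer_succ_of_commute (fix 2 (by norm_num))
      (ball 3 (by norm_num) (by norm_num)) (ball 1 (by norm_num) (by norm_num)) fun y hy hne => ?_
    obtain ⟨u, hu, huy⟩ := hΓ.moufang c hc (i + 2) (c (i + 1)) y (e₂ ▸ (hc.2 (i + 1)).symm)
      (by rw [e₃]; exact hc.1.ne h13) hy (by rwa [e₃])
    exact ⟨u, hcomm₂ u hu, by rwa [Nat.cast_one]⟩
  have ball₄ : θ ∈ Γ.ballFixer (c (i + 4)) 2 := by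
    refine hΓ.hexagon.mem_ballFixer_succ_of_commute (fix 4 (by norm_num))
      (ball 3 (by norm_num) (by norm_num)) (ball 5 (by norm_num) (by norm_num)) fun y hy hne => ?_
    obtain ⟨u, hu, huy⟩ := hΓ.exists_mem_rootGroup_smul_eq hc (i - 2) (y := c (i + 5)) (y' := y)
      (by rw [e₄', ← e₅]; exact hc.2 (i + 4)) (by rw [e₃']; exact hc.1.ne h53) (by rwa [e₄'])
      (by rwa [e₃'])
    exact ⟨u, hcomm u hu, huy⟩
  refine hΓ.hexagon.mem_ballFixer_succ_of_commute (fix 3 (by norm_num)) ball₄ ball₂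
    fun y hy hne => ?_
  obtain ⟨u, hu, huy⟩ := hΓ.moufang c hc (i + 3) (c (i + 2)) y (e₃ ▸ (hc.2 (i + 2)).symm)
    (by rw [e₄]; exact hc.1.ne h24) hy (by rwa [e₄])
  exact ⟨u, hcomm₃ u hu, huy⟩

/-! ### Labelled root groups -/

section Labelling

variable {G : Type*} [Group G] {A : Type*} [AddCommGroup A] {U : Subgroup G} {x : A → G}

theorem comm_eq_commutatorElement (g h : G) : comm g h = ⁅g⁻¹, h⁻¹⁆ := by
  rw [comm, commutatorElement_def, inv_inv, inv_inv]

theorem comm_eq_one_iff_commute {g h : G} : comm g h = 1 ↔ Commute g h := by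
  rw [comm_eq_commutatorElement, commutatorElement_eq_one_iff_commute, Commute.inv_inv_iff]

namespace IsLabelling

variable (h : IsLabelling U x)
include h

theorem mem (a : A) : x a ∈ U := by
  rw [← SetLike.mem_coe, ← h.2.1]
  exact Set.mem_range_self a

theorem exists_eq {g : G} (hg : g ∈ U) : ∃ a, x a = g := by
  rwa [← Set.mem_range, h.2.1]

theorem map_zero : x 0 = 1 := by
  simpa only [add_zero, left_eq_mul] using h.2.2 0 0

theorem map_neg (a : A) : x (-a) = (x a)⁻¹ := by
  rw [eq_inv_iff_mul_eq_one, ← h.2.2, neg_add_cancel, h.map_zero]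

theorem eq_one_iff {a : A} : x a = 1 ↔ a = 0 := by
  rw [← h.map_zero, h.1.eq_iff]

end IsLabelling

end Labelling

namespace AssociatedTo

variable {F : Type u} {J : Type v} [Field F] [AddCommGroup J] [Module F J]
  {S : HexagonalSystem F J} (A : Γ.AssociatedTo S)

include A in
theorem exists_apt_six_eq_line : ∃ l, A.apt 6 = Sum.inr l := by
  obtain ⟨p, hp⟩ := A.apt_point
  have hadj : Γ.incGraph.Adj (A.apt 6) (Sum.inl p) := hp ▸ A.isApartment.2 6
  rcases hadj with ⟨_, _, -, h, -⟩ | ⟨_, l, h, -⟩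
  · exact absurd h Sum.inl_ne_inr
  · exact ⟨l, h⟩

variable (hΓ : Γ.IsMoufangHexagon)
include hΓ

theorem exists_conj_eq_x₃ {θ : Γ.Collineation} (hθ : Γ.FixesExactlyLineBall θ) :
    ∃ g a, a ≠ 0 ∧ g * θ * g⁻¹ = A.x₃ a ∧ A.x₃ a ∈ Γ.ballFixer (A.apt 6) 3 := by
  obtain ⟨l, hl⟩ := hθ
  replace hl (x : P ⊕ L) : θ • x = x ↔ Γ.incGraph.dist (Sum.inr l) x ≤ 3 :=
    (hl x).trans hΓ.hexagon.edist_le_iff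
  obtain ⟨l', hl'⟩ := A.exists_apt_six_eq_line
  obtain ⟨g, hg⟩ := hΓ.exists_smul_eq (x := Sum.inr l) (y := Sum.inr l') rfl
  have hball : g * θ * g⁻¹ ∈ Γ.ballFixer (A.apt 6) 3 := by
    rw [hl', ← hg]
    exact conj_mem_ballFixer (mem_ballFixer.2 fun y => (hl y).2) g
  obtain ⟨a, ha⟩ := A.label₃.exists_eq
    (hΓ.hexagon.ballFixer_three_le_rootGroup A.isApartment (i := 3) hball)
  refine ⟨g, a, ?_, ha.symm, ha ▸ hball⟩
  rintro rfl
  have hone : θ = 1 := by rwa [A.label₃.map_zero, eq_comm, conj_eq_one_iff] at ha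
  obtain ⟨c, hc, ⟨i, hi⟩, -⟩ := hΓ.hexagon.exists_apartment (Sum.inr l) (Sum.inr l)
  have hd := hΓ.hexagon.dist_apartment hc i (n := 6) le_rfl
  have hle := (hl (c (i + (6 : ℕ)))).1 (by rw [hone, one_smul])
  rw [← hi, hd] at hle
  omega

theorem T_eq_zero_of_x₃_mem_ballFixer {a : J} (ha : A.x₃ a ∈ Γ.ballFixer (A.apt 6) 3) (b : J) :
    S.T a b = 0 := by
  have hfix : (A.x₁ b)⁻¹ • A.apt 6 = A.apt 6 :=
    A.isApartment.smul_of_mem_rootGroup (inv_mem (A.label₁.mem b)) (k := 5) (by norm_num)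
  have hball : A.x₂ (S.T b a) ∈ Γ.ballFixer (A.apt 6) 3 := by
    rw [← A.comm₁₃, comm_eq_commutatorElement]
    exact commutatorElement_mem_ballFixer (inv_mem ha) hfix
  have h9 : Γ.incGraph.dist (A.apt 6) (A.apt 9) = 3 :=
    hΓ.hexagon.dist_apartment A.isApartment 6 (n := 3) (by norm_num)
  rw [S.T_symm, ← A.label₂.eq_one_iff]
  exact hΓ.hexagon.eq_one_of_mem_rootGroup A.isApartment hΓ.thick (A.label₂.mem _)
    (mem_ballFixer.1 hball _ h9.le)

section TraceZero

variable (hT : S.T = 0)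
include hT

theorem x₃_mem_ballFixer (a : J) : A.x₃ a ∈ Γ.ballFixer (A.apt 6) 3 := by
  have hball := hΓ.mem_ballFixer_three_of_commute A.isApartment (A.label₃.mem a)
  have e₁ : (3 - 2 : ZMod 12) = 1 := by decide
  have e₅ : (3 + 2 : ZMod 12) = 5 := by decide
  have e₆ : (3 + 3 : ZMod 12) = 6 := by decide
  rw [e₁, e₅, e₆] at hball
  refine hball (fun u hu => ?_) (fun u hu => ?_) fun u hu => ?_
  · obtain ⟨b, rfl⟩ := A.label₁.exists_eq hu
    rw [← comm_eq_one_iff_commute, A.comm₁₃, hT]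
    exact A.label₂.map_zero
  · obtain ⟨b, rfl⟩ := A.label₅.exists_eq hu
    rw [Commute.symm_iff, ← comm_eq_one_iff_commute, A.comm₃₅, hT]
    exact A.label₄.map_zero
  · obtain ⟨t, rfl⟩ := A.label₆.exists_eq hu
    exact (comm_eq_one_iff_commute.1 (A.comm₃₆ a t)).symm

theorem fixesExactlyLineBall_x₃ {a : J} (ha : a ≠ 0) : Γ.FixesExactlyLineBall (A.x₃ a) := by
  obtain ⟨l, hl⟩ := A.exists_apt_six_eq_line
  refine ⟨l, fun x => Iff.trans ?_ hΓ.hexagon.edist_le_iff.symm⟩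
  rw [← hl]
  exact hΓ.hexagon.smul_eq_self_iff_of_mem_ballFixer_three hΓ.thick
    (A.x₃_mem_ballFixer hΓ hT a) (mt A.label₃.eq_one_iff.1 ha) x

theorem rootGroup_le_ballFixer_three (k : ZMod 12) :
    Γ.rootGroup A.apt (2 * k + 1) ≤ Γ.ballFixer (A.apt (2 * k + 4)) 3 := by
  intro θ hθ
  obtain ⟨g, hg⟩ := hΓ.exists_reflection A.isApartment (k + 5)
  have hroot : 2 * (k + 5) - (2 * k + 1) - 6 = 3 := by ring
  have hcenter : 2 * (k + 5) - (2 * k + 4) = 6 := by ring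
  obtain ⟨a, ha⟩ := A.label₃.exists_eq (hroot ▸ conj_mem_rootGroup_of_reflection hg hθ)
  have hconj := conj_mem_ballFixer (A.x₃_mem_ballFixer hΓ hT a) g⁻¹
  rwa [ha, inv_smul_eq_iff.2 ((hg (2 * k + 4)).trans (congrArg A.apt hcenter)).symm,
    ← mul_assoc, inv_inv, ← mul_assoc, inv_mul_cancel, one_mul, inv_mul_cancel_right] at hconj

theorem commute_of_mem_rootGroup_five_seven {g h : Γ.Collineation}
    (hg : g ∈ Γ.rootGroup A.apt 5) (hh : h ∈ Γ.rootGroup A.apt 7) : Commute g h := by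
  have hd : Γ.incGraph.dist (A.apt 8) (A.apt 10) = 2 :=
    hΓ.hexagon.dist_apartment A.isApartment 8 (n := 2) (by norm_num)
  exact hΓ.hexagon.commute_of_mem_ballFixer_three hΓ.thick
    (A.rootGroup_le_ballFixer_three hΓ hT 2 hg) (A.rootGroup_le_ballFixer_three hΓ hT 3 hh)
    (A.isApartment.1.ne (by decide)) (hd.trans_le (by norm_num))

omit hΓ in
theorem conj_x₁_x₅ (a b : J) :
    (A.x₁ a)⁻¹ * A.x₅ b * A.x₁ a = A.x₅ b * A.x₃ (S.mul a b) := by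
  have hcomm : comm (A.x₁ a) (A.x₅ b) = A.x₃ (S.cross a b) := by
    simp only [A.comm₁₅, hT, LinearMap.zero_apply, neg_zero, A.label₂.map_zero,
      A.label₄.map_zero, one_mul, mul_one]
  rw [S.mul_apply, A.label₃.map_neg, ← hcomm, comm]
  group

theorem conj_x₅_smul_apt_ten {a b : J} {y y' : Γ.Collineation}
    (hy : y ∈ Γ.rootGroup A.apt 7) (hy' : y' ∈ Γ.rootGroup A.apt 7) :
    ((y * A.x₁ a * y')⁻¹ * A.x₅ b * (y * A.x₁ a * y')) • A.apt 10 =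
      A.x₃ (S.mul a b) • A.apt 10 := by
  have hyb : y⁻¹ * A.x₅ b * y = A.x₅ b := by
    rw [mul_assoc, A.commute_of_mem_rootGroup_five_seven hΓ hT (A.label₅.mem b) hy,
      inv_mul_cancel_left]
  have hconj : (y * A.x₁ a * y')⁻¹ * A.x₅ b * (y * A.x₁ a * y') =
      y'⁻¹ * (A.x₅ b * (A.x₃ (S.mul a b) * y')) := by
    calc _ = y'⁻¹ * ((A.x₁ a)⁻¹ * (y⁻¹ * A.x₅ b * y) * A.x₁ a) * y' := by group
      _ = _ := by rw [hyb, A.conj_x₁_x₅ hT]; group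
  have hy'₁₀ : y' • A.apt 10 = A.apt 10 :=
    A.isApartment.smul_of_mem_rootGroup hy' (k := 3) (by norm_num)
  have hx₃ : A.x₃ (S.mul a b) • A.apt 9 = A.apt 9 :=
    A.isApartment.smul_of_mem_rootGroup (A.label₃.mem _) (k := 6) le_rfl
  have hadj : Γ.incGraph.Adj (A.apt 9) (A.x₃ (S.mul a b) • A.apt 10) := by
    have h := (A.x₃ (S.mul a b)).adj_smul_iff.2 (A.isApartment.2 9)
    rwa [hx₃] at h
  have hx₅ : A.x₅ b • A.x₃ (S.mul a b) • A.apt 10 = A.x₃ (S.mul a b) • A.apt 10 :=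
    A.label₅.mem b 4 (by norm_num) (by norm_num) _ hadj
  have hy'₃ : y' • A.x₃ (S.mul a b) • A.apt 10 = A.x₃ (S.mul a b) • A.apt 10 :=
    hy' 2 (by norm_num) (by norm_num) _ hadj
  rw [hconj, mul_smul, mul_smul, mul_smul, hy'₁₀, hx₅, inv_smul_eq_iff, hy'₃]

theorem isConj_x₅_x₃ {a : J} (ha : a ≠ 0) (b : J) :
    IsConj (A.x₅ b) (A.x₃ (S.mul a b)) := by
  obtain ⟨y, hy, y', hy', hm⟩ := hΓ.exists_reflection_of_mem A.isApartment (A.label₁.mem a)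
    fun h => ha <| A.label₁.eq_one_iff.1 <|
      hΓ.hexagon.eq_one_of_mem_rootGroup A.isApartment hΓ.thick (A.label₁.mem a) h
  set m := y * A.x₁ a * y'
  have hm' (j : ZMod 12) : m⁻¹ • A.apt j = A.apt (2 * 1 - j) := by
    rw [inv_smul_eq_iff, hm, sub_sub_cancel]
  have hroot : (2 * 1 - 5 - 6 : ZMod 12) = 3 := by decide
  have hmem : m⁻¹ * A.x₅ b * m ∈ Γ.rootGroup A.apt 3 := by
    simpa only [inv_inv, hroot] using conj_mem_rootGroup_of_reflection hm' (A.label₅.mem b)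
  refine isConj_iff.2 ⟨m⁻¹, ?_⟩
  rw [inv_inv]
  exact hΓ.hexagon.rootGroup_ext A.isApartment hΓ.thick hmem (A.label₃.mem _)
    (A.conj_x₅_smul_apt_ten hΓ hT hy hy')

theorem isConj_x₃_one {a : J} (ha : a ≠ 0) : IsConj (A.x₃ a) (A.x₃ S.one) := by
  have h := A.isConj_x₅_x₃ hΓ hT ha S.one
  have h₁ := A.isConj_x₅_x₃ hΓ hT S.one_ne_zero S.one
  rw [S.mul_one hT] at h h₁
  exact h.symm.trans h₁

end TraceZero

end AssociatedTo

variable {F : Type u} {J : Type v} [Field F] [AddCommGroup J] [Module F J]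
  {S : HexagonalSystem F J}

theorem AssociatedTo.T_eq_zero (A : Γ.AssociatedTo S) (hΓ : Γ.IsMoufangHexagon)
    {θ : Γ.Collineation} (hθ : Γ.FixesExactlyLineBall θ) : S.T = 0 := by
  obtain ⟨_, a, ha, -, hball⟩ := A.exists_conj_eq_x₃ hΓ hθ
  exact S.T_eq_zero_of_radical ha (A.T_eq_zero_of_x₃_mem_ballFixer hΓ hball)

theorem AssociatedTo.inClassH4 (A : Γ.AssociatedTo S) (hT : S.T = 0) : InClassH4.{u, v} Γ := by
  let _ := S.field hT
  let _ := S.algebra hT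
  exact ⟨F, J, _, _, _, S.charP_three hT, _, ⟨S.eq_mixedSystem hT ▸ A⟩⟩

theorem InClassH4.exists_fixesExactlyLineBall (h : InClassH4.{u, v} Γ)
    (hΓ : Γ.IsMoufangHexagon) : ∃ θ : Γ.Collineation, Γ.FixesExactlyLineBall θ := by
  obtain ⟨F, E, _, _, _, _, h, ⟨A⟩⟩ := h
  exact ⟨_, A.fixesExactlyLineBall_x₃ hΓ rfl (mixedSystem F E h).one_ne_zero⟩

end PointLineGeometry

theorem mainTheorem11 {P : Type w} {L : Type z} {F : Type u} {J : Type v}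
    [Field F] [AddCommGroup J] [Module F J]
    (Γ : PointLineGeometry P L) (hΓ : Γ.IsMoufangHexagon)
    (S : HexagonalSystem F J) (A : Γ.AssociatedTo S) :
    ((∃ θ : Γ.Collineation, Γ.FixesExactlyLineBall θ) ↔
      PointLineGeometry.InClassH4.{u, v} Γ) ∧
    (PointLineGeometry.InClassH4.{u, v} Γ →
      ∀ θ : Γ.Collineation, Γ.FixesExactlyLineBall θ → IsConj θ (A.x₃ S.one)) := by
  refine ⟨⟨fun ⟨θ, hθ⟩ => A.inClassH4 (A.T_eq_zero hΓ hθ),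
    fun h => h.exists_fixesExactlyLineBall hΓ⟩, fun _ θ hθ => ?_⟩
  obtain ⟨g, a, ha, hg, -⟩ := A.exists_conj_eq_x₃ hΓ hθ
  exact (isConj_iff.2 ⟨g, hg⟩).trans (A.isConj_x₃_one hΓ (A.T_eq_zero hΓ hθ) ha)
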